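/- Let $F10$ be the Petersen graph and $F28$ the Coxeter graph. For a graph $X$, let $L(X)$ be its line graph, and let $K(X)$ be the graph whose vertices are the arcs (ordered pairs of adjacent vertices) of $X$, in which any two distinct arcs $(x,y)$ and $(x,z)$ with the same initial vertex are adjacent, each arc $(x,y)$ is adjacent to its reverse $(y,x)$, and there are no other adjacencies. A Hamilton decomposition of a $k$-valent graph is a set of $\lfloor k/2\rfloor$ pairwise edge-disjoint Hamilton cycles in it. Then $K(L(F10))$ and $K(L(F28))$ are connected $4$-valent graphs that have no Hamilton decomposition; $K(L(F10))$ is a Cayley graph on the alternating group $\mathrm{Alt}(5)$, and $K(L(F28))$ is a Cayley graph on the projective special linear group $\mathrm{PSL}(2,7)$. -/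

import Mathlib

namespace HamDecomp

/-- The Petersen graph: the vertices are the `2`-subsets of a `5`-set,
and two of them are adjacent if and only if they are disjoint. -/
def petersenGraph : SimpleGraph {s : Finset (Fin 5) // s.card = 2} where
  Adj s t := Disjoint s.1 t.1
  symm := ⟨fun _ _ h => h.symm⟩
  loopless := ⟨fun s h => by
    have h0 : s.1 = ∅ := by simpa using h
    have h2 := s.2
    simp [h0] at h2⟩

/-- The Coxeter graph: the vertices are the `3`-subsets of the point set `Fin 7` of the Fano plane
that are not lines, where the lines are the seven translates `{i, i + 1, i + 3}` modulo `7`;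
two vertices are adjacent if and only if they are disjoint. -/
def coxeterGraph :
    SimpleGraph {s : Finset (Fin 7) // s.card = 3 ∧ ∀ i : Fin 7, s ≠ {i, i + 1, i + 3}} where
  Adj s t := Disjoint s.1 t.1
  symm := ⟨fun _ _ h => h.symm⟩
  loopless := ⟨fun s h => by
    have h0 : s.1 = ∅ := by simpa using h
    have h2 := s.2.1
    simp [h0] at h2⟩

instance : DecidableRel petersenGraph.Adj :=
  fun s t => inferInstanceAs (Decidable (Disjoint s.1 t.1))

instance : DecidableRel coxeterGraph.Adj :=
  fun s t => inferInstanceAs (Decidable (Disjoint s.1 t.1))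

instance {V : Type*} [Fintype V] [DecidableEq V] (X : SimpleGraph V) :
    DecidableRel X.lineGraph.Adj :=
  fun _ _ => decidable_of_iff _ SimpleGraph.lineGraph_adj_iff_exists.symm

/-- The graph `K(X)`. Its vertices are the arcs (darts) of `X`; two distinct arcs emanating from the
same vertex are adjacent, and each arc `(x, y)` is adjacent to its reverse `(y, x)`. -/
def arcGraph {V : Type*} (X : SimpleGraph V) : SimpleGraph X.Dart where
  Adj a b := (a ≠ b ∧ a.fst = b.fst) ∨ b = a.symm
  symm := ⟨by
    rintro a b (⟨h, h'⟩ | rfl)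
    · exact Or.inl ⟨h.symm, h'.symm⟩
    · exact Or.inr (by simp)⟩
  loopless := ⟨by
    rintro a (⟨h, _⟩ | h)
    · exact h rfl
    · exact a.symm_ne h.symm⟩

instance {V : Type*} [DecidableEq V] (X : SimpleGraph V) : DecidableRel (arcGraph X).Adj :=
  fun a b => inferInstanceAs (Decidable ((a ≠ b ∧ a.fst = b.fst) ∨ b = a.symm))

instance {V : Type*} [Fintype V] [DecidableEq V] (X : SimpleGraph V) [DecidableRel X.Adj] :
    (arcGraph X).LocallyFinite :=
  fun _ => inferInstance

/-- `X` is a Cayley graph on the group `Γ`: it is isomorphic to the Cayley graph of `Γ` with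
respect to some inverse-closed connection set that does not contain the identity. -/
def IsCayleyGraphOn {V : Type*} (X : SimpleGraph V) (Γ : Type*) [Group Γ] : Prop :=
  ∃ S : Set Γ, (1 : Γ) ∉ S ∧ (∀ g ∈ S, g⁻¹ ∈ S) ∧ Nonempty (X ≃g SimpleGraph.mulCayley S)

/-- A `k`-valent graph `X` has a Hamilton decomposition if it contains `⌊k / 2⌋` pairwise
edge-disjoint Hamilton cycles. -/
def HasHamiltonDecomposition {V : Type*} [DecidableEq V] (X : SimpleGraph V)
    [X.LocallyFinite] : Prop :=
  ∃ k : ℕ, X.IsRegularOfDegree k ∧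
    ∃ (v : Fin (k / 2) → V) (C : ∀ i, X.Walk (v i) (v i)),
      (∀ i, (C i).IsHamiltonianCycle) ∧
      ∀ i j, i ≠ j → (C i).edges.Disjoint (C j).edges

end HamDecomp

/-!
Let `X` be a cubic graph. In `K(L(X))` every vertex of the `4`-valent graph `L(X)` is replaced by the
complete graph on the four arcs that leave it. Two edge-disjoint Hamilton cycles of `K(L(X))` use all
of its edges. Each of them crosses the cut around such a complete graph in a positive even number of
edges, so each uses exactly two of the four edges of the cut, and contracting the complete graphs
gives a Hamilton decomposition of `L(X)` (`HamiltonPair.of_arcGraph`).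

By an argument of Kotzig, `X` is then hamiltonian (`HamiltonPair.exists_isHamiltonMatching`). The edges
of `L(X)` form one triangle for each vertex `x` of `X`. Such a triangle lies in neither of the two
cycles, so one cycle has two of its sides, which share one of the three edges at `x`, the centre. An
edge that is the centre at one end is the centre at the other end, for the other cycle. The centres
therefore form a perfect matching of `X`. If its complement were disconnected, then one of the two
cycles of `L(X)` would be disconnected too.

The Petersen graph and the Coxeter graph are not hamiltonian: every perfect matching of theirs has a
disconnected complement. This is verified by a backtracking search through the perfect matchings,
proved correct in `IsNeighborList.not_isHamiltonMatching` and evaluated by the kernel.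

The arcs of `L(X)` are the `2`-arcs of `X`, of which there are `6 * |X|`, and a group of automorphisms
of `X` of this order acts regularly on them as soon as only the identity fixes a certain `2`-arc
(`isCayleyGraphOn_arcGraph_lineGraph`). For the Petersen graph this applies to `Alt(5)`, of order `60`.
For the Coxeter graph it applies to `PSL(2,7)`, of order `168`: the vertices of the Coxeter graph
correspond to the `28` pairs of points of the projective line over the field with seven elements, two
of them adjacent when they are harmonic (`coxeterIso`). A pair of points is encoded by the binary
quadratic form that vanishes on it, that is, by a symmetric matrix of determinant `-1` up to sign, on
which `SL(2,7)` acts by congruence.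
-/

namespace HamDecomp

/-! ### Hamilton decompositions as pairs of connected `2`-regular subgraphs -/

/-- `H` and `K` are connected `2`-regular spanning subgraphs of `W` that partition its edges; on a
finite vertex set with at least three elements, these are the two Hamilton cycles of a Hamilton
decomposition of a `4`-valent graph. -/
structure HamiltonPair {V : Type*} (W H K : SimpleGraph V) : Prop where
  adj_iff : ∀ a b, W.Adj a b ↔ H.Adj a b ∨ K.Adj a b
  disjoint : ∀ a b, H.Adj a b → ¬ K.Adj a b
  connected_left : H.Preconnected
  connected_right : K.Preconnected
  ncard_left : ∀ v, (H.neighborSet v).ncard = 2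
  ncard_right : ∀ v, (K.neighborSet v).ncard = 2

namespace HamiltonPair

variable {V : Type*} {W H K : SimpleGraph V}

theorem symm (h : HamiltonPair W H K) : HamiltonPair W K H where
  adj_iff a b := (h.adj_iff a b).trans or_comm
  disjoint a b hK hH := h.disjoint a b hH hK
  connected_left := h.connected_right
  connected_right := h.connected_left
  ncard_left := h.ncard_right
  ncard_right := h.ncard_left

theorem right_of_not_left (h : HamiltonPair W H K) {a b : V} (hab : W.Adj a b)
    (hn : ¬ H.Adj a b) : K.Adj a b :=
  ((h.adj_iff a b).1 hab).resolve_left hn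

end HamiltonPair

section Cycles

variable {V : Type*} [DecidableEq V] {W : SimpleGraph V}

theorem preconnected_fromEdgeSet_edges {v : V} {C : W.Walk v v} (hC : C.IsHamiltonianCycle) :
    (SimpleGraph.fromEdgeSet {e | e ∈ C.edges}).Preconnected := by
  have key : ∀ {a b : V} (p : W.Walk a b), (∀ e ∈ p.edges, e ∈ C.edges) →
      (SimpleGraph.fromEdgeSet {e | e ∈ C.edges}).Reachable a b := by
    intro a b p
    induction p with
    | nil => intro _; exact SimpleGraph.Reachable.refl _
    | cons h p ih =>
      intro hp
      refine SimpleGraph.Reachable.trans (SimpleGraph.Adj.reachable ?_)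
        (ih fun e he => hp e (by simp [he]))
      exact (SimpleGraph.fromEdgeSet_adj _).2 ⟨hp _ (by simp), h.ne⟩
  have hv : ∀ b, (SimpleGraph.fromEdgeSet {e | e ∈ C.edges}).Reachable v b := fun b =>
    key (C.takeUntil b (hC.mem_support b)) fun e he =>
      SimpleGraph.Walk.edges_takeUntil_subset_edges _ _ he
  exact fun a b => (hv a).symm.trans (hv b)

theorem ncard_neighborSet_fromEdgeSet_edges {v : V} {C : W.Walk v v} (hC : C.IsHamiltonianCycle)
    (u : V) : ((SimpleGraph.fromEdgeSet {e | e ∈ C.edges}).neighborSet u).ncard = 2 := by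
  rw [← hC.isCycle.ncard_neighborSet_toSubgraph_eq_two (hC.mem_support u)]
  congr 1
  ext w
  simp only [SimpleGraph.mem_neighborSet, SimpleGraph.fromEdgeSet_adj, Set.mem_ofPred_eq,
    SimpleGraph.Subgraph.mem_neighborSet, SimpleGraph.Walk.adj_toSubgraph_iff_mem_edges]
  exact ⟨fun h => h.1, fun h => ⟨h, (C.adj_of_mem_edges h).ne⟩⟩

theorem HasHamiltonDecomposition.exists_hamiltonPair [Nonempty V] [W.LocallyFinite]
    (hW : W.IsRegularOfDegree 4) (h : HasHamiltonDecomposition W) :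
    ∃ H K : SimpleGraph V, HamiltonPair W H K := by
  obtain ⟨k, hk, v, C, hC, hdis⟩ := h
  obtain rfl : k = 4 := by
    rw [← hk (Classical.arbitrary V), hW (Classical.arbitrary V)]
  have hlt : ∀ i a b, (SimpleGraph.fromEdgeSet {e | e ∈ (C i).edges}).Adj a b → W.Adj a b :=
    fun i a b hab => (C i).adj_of_mem_edges ((SimpleGraph.fromEdgeSet_adj _).1 hab).1
  have hd : ∀ a b, (SimpleGraph.fromEdgeSet {e | e ∈ (C 0).edges}).Adj a b →
      ¬ (SimpleGraph.fromEdgeSet {e | e ∈ (C 1).edges}).Adj a b := by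
    intro a b h0 h1
    exact hdis 0 1 (by decide) ((SimpleGraph.fromEdgeSet_adj _).1 h0).1
      ((SimpleGraph.fromEdgeSet_adj _).1 h1).1
  refine ⟨.fromEdgeSet {e | e ∈ (C 0).edges}, .fromEdgeSet {e | e ∈ (C 1).edges},
    fun a b => ⟨fun hab => ?_, fun hab => hab.elim (hlt 0 a b) (hlt 1 a b)⟩, hd,
    preconnected_fromEdgeSet_edges (hC 0), preconnected_fromEdgeSet_edges (hC 1),
    ncard_neighborSet_fromEdgeSet_edges (hC 0), ncard_neighborSet_fromEdgeSet_edges (hC 1)⟩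
  -- the two cycles already account for all four edges at `a`
  have hcard : (W.neighborSet a).ncard = 4 := by
    rw [← hW a, ← SimpleGraph.card_neighborSet_eq_degree, ← Nat.card_eq_fintype_card]; rfl
  have hfin : (W.neighborSet a).Finite := Set.toFinite _
  have hsub : (SimpleGraph.fromEdgeSet {e | e ∈ (C 0).edges}).neighborSet a ∪
      (SimpleGraph.fromEdgeSet {e | e ∈ (C 1).edges}).neighborSet a ⊆ W.neighborSet a :=
    Set.union_subset (fun b => hlt 0 a b) (fun b => hlt 1 a b)
  have hdisj : Disjoint ((SimpleGraph.fromEdgeSet {e | e ∈ (C 0).edges}).neighborSet a)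
      ((SimpleGraph.fromEdgeSet {e | e ∈ (C 1).edges}).neighborSet a) :=
    Set.disjoint_left.2 fun b => hd a b
  have hun := Set.eq_of_subset_of_ncard_le hsub (by
    rw [Set.ncard_union_eq hdisj
      (hfin.subset fun b => hlt 0 a b) (hfin.subset fun b => hlt 1 a b),
      ncard_neighborSet_fromEdgeSet_edges (hC 0), ncard_neighborSet_fromEdgeSet_edges (hC 1),
      hcard]) hfin
  have : b ∈ W.neighborSet a := hab
  rwa [← hun] at this

end Cycles

/-! ### Contraction of the arc graph -/

section Descend

variable {V : Type*} {Y : SimpleGraph V}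

/-- The subgraph of `Y` formed by those edges whose two arcs are joined in the graph `H` on the
arcs of `Y`; for `H ≤ arcGraph Y`, the result of contracting the arcs with a common initial vertex
to that vertex. -/
def contractArcs (H : SimpleGraph Y.Dart) : SimpleGraph V where
  Adj u v := ∃ d : Y.Dart, d.fst = u ∧ d.snd = v ∧ H.Adj d d.symm
  symm := ⟨by
    rintro _ _ ⟨d, rfl, rfl, h⟩
    exact ⟨d.symm, rfl, rfl, by simpa using h.symm⟩⟩
  loopless := ⟨by
    rintro u ⟨d, h1, h2, _⟩
    exact d.adj.ne (h1.trans h2.symm)⟩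

theorem contractArcs_preconnected {H : SimpleGraph Y.Dart} (hle : H ≤ arcGraph Y)
    (hH : H.Preconnected) (hY : ∀ u, ∃ v, Y.Adj u v) : (contractArcs H).Preconnected := by
  have key : ∀ {a b : Y.Dart}, H.Walk a b → (contractArcs H).Reachable a.fst b.fst := by
    intro a b p
    induction p with
    | nil => exact SimpleGraph.Reachable.refl _
    | @cons a b c h p ih =>
      refine SimpleGraph.Reachable.trans ?_ ih
      rcases hle h with ⟨-, h'⟩ | rfl
      · rw [h']
      · exact SimpleGraph.Adj.reachable ⟨a, rfl, rfl, h⟩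
  intro u v
  obtain ⟨u', hu⟩ := hY u
  obtain ⟨v', hv⟩ := hY v
  obtain ⟨p⟩ := hH ⟨(u, u'), hu⟩ ⟨(v, v'), hv⟩
  exact key p

theorem ncard_neighborSet_pos [Nontrivial V] [Finite V] {G : SimpleGraph V}
    (hG : G.Preconnected) (u : V) : 0 < (G.neighborSet u).ncard := by
  obtain ⟨v, hv⟩ := exists_ne u
  obtain ⟨p⟩ := hG u v
  cases p with
  | nil => exact absurd rfl hv
  | cons h p => exact (Set.ncard_pos (Set.toFinite _)).2 ⟨_, h⟩

/-- A `2`-regular subgraph of `arcGraph Y` meets the edge cut around the arcs at a vertex `u` in an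
even number of edges, by the handshake lemma for the arcs at `u`. -/
theorem even_ncard_neighborSet_contractArcs [Finite V] {H : SimpleGraph Y.Dart}
    (hle : H ≤ arcGraph Y) (hH : ∀ d, (H.neighborSet d).ncard = 2) (u : V) :
    Even ((contractArcs H).neighborSet u).ncard := by
  classical
  have := Fintype.ofFinite V
  let S : Set Y.Dart := {d | d.fst = u}
  have hev := (H.induce S).even_card_odd_degree_vertices
  have hodd : ∀ d : S, Odd ((H.induce S).degree d) ↔ H.Adj d.1 d.1.symm := by
    rintro ⟨d, hd⟩
    have hdeg : (H.induce S).degree ⟨d, hd⟩ = (H.neighborSet d ∩ S).ncard := by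
      rw [← SimpleGraph.card_neighborSet_eq_degree, ← Nat.card_eq_fintype_card,
        Nat.card_coe_set_eq]
      rw [← Set.ncard_image_of_injective _ Subtype.val_injective]
      congr 1
      ext b
      simp only [Set.mem_image, SimpleGraph.mem_neighborSet, SimpleGraph.comap_adj,
        Set.mem_inter_iff, Subtype.exists]
      constructor
      · rintro ⟨b, hb, h, rfl⟩; exact ⟨h, hb⟩
      · rintro ⟨h, hb⟩; exact ⟨b, hb, h, rfl⟩
    have hsymm : d.symm ∉ S := fun h => d.adj.ne (hd.trans h.symm)
    rw [hdeg]
    by_cases hadj : H.Adj d d.symm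
    · have : H.neighborSet d ∩ S = H.neighborSet d \ {d.symm} := by
        ext b
        constructor
        · rintro ⟨h, hb⟩
          exact ⟨h, fun h' => hsymm (h' ▸ hb)⟩
        · rintro ⟨h, hb⟩
          rcases hle h with ⟨-, h'⟩ | h'
          · exact ⟨h, h'.symm.trans hd⟩
          · exact absurd h' hb
      have hmem : d.symm ∈ H.neighborSet d := hadj
      rw [this, Set.ncard_sdiff_singleton_of_mem hmem, hH]
      exact iff_of_true odd_one hadj
    · have : H.neighborSet d ∩ S = H.neighborSet d := by
        refine Set.inter_eq_left.2 fun b h => ?_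
        rcases hle h with ⟨-, h'⟩ | h'
        · exact h'.symm.trans hd
        · exact absurd (h' ▸ h) hadj
      rw [this, hH]
      exact iff_of_false (by decide) hadj
  have himg : (contractArcs H).neighborSet u =
      (fun d : S => d.1.snd) '' {d : S | H.Adj d.1 d.1.symm} := by
    ext w
    constructor
    · rintro ⟨d, h1, h2, h3⟩
      exact ⟨⟨d, h1⟩, h3, h2⟩
    · rintro ⟨⟨d, h1⟩, h3, h2⟩
      exact ⟨d, h1, h2, h3⟩
  rw [himg, Set.ncard_image_of_injective, Set.ncard_eq_toFinset_card']
  · convert hev using 2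
    ext d
    simp [hodd]
  · rintro ⟨d, hd⟩ ⟨e, he⟩ h
    apply Subtype.ext
    apply SimpleGraph.Dart.ext
    exact Prod.ext (hd.trans he.symm) h

/-- A Hamilton decomposition of `arcGraph Y` contracts to one of `Y`: the two cycles use all four
edges leaving the arcs at a vertex, and each of them uses a positive even number. -/
theorem HamiltonPair.of_arcGraph [Finite V] [Nontrivial V] {H K : SimpleGraph Y.Dart}
    (hY : ∀ u, (Y.neighborSet u).ncard = 4) (h : HamiltonPair (arcGraph Y) H K) :
    HamiltonPair Y (contractArcs H) (contractArcs K) := by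
  have hex : ∀ u, ∃ v, Y.Adj u v := fun u =>
    (Set.ncard_pos (Set.toFinite (Y.neighborSet u))).1 (by rw [hY]; norm_num)
  have hH : H ≤ arcGraph Y := fun a b hab => (h.adj_iff a b).2 (Or.inl hab)
  have hK : K ≤ arcGraph Y := fun a b hab => (h.adj_iff a b).2 (Or.inr hab)
  have hiff : ∀ u v, Y.Adj u v ↔
      (contractArcs H).Adj u v ∨ (contractArcs K).Adj u v := by
    intro u v
    constructor
    · intro huv
      have : (arcGraph Y).Adj ⟨(u, v), huv⟩ (SimpleGraph.Dart.symm ⟨(u, v), huv⟩) := Or.inr rfl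
      exact ((h.adj_iff _ _).1 this).imp (fun h' => ⟨_, rfl, rfl, h'⟩) fun h' => ⟨_, rfl, rfl, h'⟩
    · rintro (⟨d, rfl, rfl, -⟩ | ⟨d, rfl, rfl, -⟩) <;> exact d.adj
  have hdis : ∀ u v, (contractArcs H).Adj u v →
      ¬ (contractArcs K).Adj u v := by
    rintro _ _ ⟨d, rfl, rfl, hd⟩ ⟨e, h1, h2, he⟩
    obtain rfl : e = d := SimpleGraph.Dart.ext _ _ (Prod.ext h1 h2)
    exact h.disjoint _ _ hd he
  have cH := contractArcs_preconnected hH h.connected_left hex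
  have cK := contractArcs_preconnected hK h.connected_right hex
  have hsum : ∀ u, ((contractArcs H).neighborSet u).ncard = 2 ∧
      ((contractArcs K).neighborSet u).ncard = 2 := by
    intro u
    have hun : (contractArcs H).neighborSet u ∪ (contractArcs K).neighborSet u =
        Y.neighborSet u := Set.ext fun v => (hiff u v).symm
    have hdisj : Disjoint ((contractArcs H).neighborSet u) ((contractArcs K).neighborSet u) :=
      Set.disjoint_left.2 fun v => hdis u v
    have hc := hY u
    rw [← hun, Set.ncard_union_eq hdisj
      (Set.toFinite _) (Set.toFinite _)] at hc
    obtain ⟨m, hm⟩ := even_ncard_neighborSet_contractArcs hH h.ncard_left u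
    obtain ⟨n, hn⟩ := even_ncard_neighborSet_contractArcs hK h.ncard_right u
    have := ncard_neighborSet_pos cH u
    have := ncard_neighborSet_pos cK u
    omega
  exact ⟨hiff, hdis, cH, cK, fun u => (hsum u).1, fun u => (hsum u).2⟩

end Descend

/-! ### Edges at a vertex of a cubic graph -/

section LineGraph

variable {V : Type*} {X : SimpleGraph V}

/-- `JoinedAt H x y z` says that the edges `xy` and `xz` of `X` are adjacent in the graph `H` on the
edges of `X`. -/
def JoinedAt (H : SimpleGraph X.edgeSet) (x y z : V) : Prop :=
  ∃ (hy : X.Adj x y) (hz : X.Adj x z), H.Adj ⟨s(x, y), hy⟩ ⟨s(x, z), hz⟩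

theorem JoinedAt.symm {H : SimpleGraph X.edgeSet} {x y z : V} (h : JoinedAt H x y z) :
    JoinedAt H x z y :=
  let ⟨hy, hz, h⟩ := h
  ⟨hz, hy, h.symm⟩

theorem lineGraph_adj_mk_mk {x y z : V} (hy : X.Adj x y) (hz : X.Adj x z) (hyz : y ≠ z) :
    X.lineGraph.Adj ⟨s(x, y), hy⟩ ⟨s(x, z), hz⟩ := by
  refine SimpleGraph.lineGraph_adj_iff_exists.2 ⟨fun h => hyz ?_, x, by simp, by simp⟩
  exact Sym2.congr_right.1 (Subtype.ext_iff.1 h)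

/-- Adjacent vertices of the line graph are two edges `xy` and `xz` with `y ≠ z`. -/
theorem exists_of_lineGraph_adj {e f : X.edgeSet} (h : X.lineGraph.Adj e f) :
    ∃ (x y z : V) (hy : X.Adj x y) (hz : X.Adj x z), y ≠ z ∧
      e = ⟨s(x, y), hy⟩ ∧ f = ⟨s(x, z), hz⟩ := by
  obtain ⟨hne, x, hx, hx'⟩ := SimpleGraph.lineGraph_adj_iff_exists.1 h
  obtain ⟨e, he⟩ := e
  obtain ⟨f, hf⟩ := f
  obtain ⟨y, rfl⟩ := Sym2.mem_iff_exists.1 hx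
  obtain ⟨z, rfl⟩ := Sym2.mem_iff_exists.1 hx'
  exact ⟨x, y, z, he, hf, fun h => hne (by subst h; rfl), rfl, rfl⟩

/-- If `H` is `2`-regular and joins the edge `xy` to two edges at `x`, then it joins `xy` to no edge
at `y`. -/
theorem not_joinedAt_of_joinedAt [Finite V] {H : SimpleGraph X.edgeSet}
    (hH : ∀ e, (H.neighborSet e).ncard = 2) {x y z z' w : V} (hz : JoinedAt H x y z)
    (hz' : JoinedAt H x y z') (hne : z ≠ z') : ¬ JoinedAt H y x w := by
  obtain ⟨hxy, hxz, h1⟩ := hz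
  obtain ⟨_, hxz', h2⟩ := hz'
  rintro ⟨hyx, hyw, h3⟩
  have heq : (⟨s(y, x), hyx⟩ : X.edgeSet) = ⟨s(x, y), hxy⟩ := Subtype.ext Sym2.eq_swap
  rw [heq] at h3
  have hwx : ∀ t, X.Adj x t → s(x, t) = s(y, w) → w = x := by
    intro t ht h
    have : x ∈ s(y, w) := h ▸ Sym2.mem_mk_left x t
    rcases Sym2.mem_iff.1 this with h' | h'
    · exact absurd h' hxy.ne
    · exact h'.symm
  have hw : w ≠ x := by
    rintro rfl
    exact h3.ne (Subtype.ext Sym2.eq_swap)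
  have hsub : ({⟨s(x, z), hxz⟩, ⟨s(x, z'), hxz'⟩, ⟨s(y, w), hyw⟩} : Set X.edgeSet) ⊆
      H.neighborSet ⟨s(x, y), hxy⟩ := by
    rintro e (rfl | rfl | rfl)
    exacts [h1, h2, h3]
  have h3 : ({⟨s(x, z), hxz⟩, ⟨s(x, z'), hxz'⟩, ⟨s(y, w), hyw⟩} : Set X.edgeSet).ncard = 3 := by
    rw [Set.ncard_eq_three]
    refine ⟨_, _, _, fun h => hne ?_, fun h => hw ?_, fun h => hw ?_, rfl⟩
    · exact Sym2.congr_right.1 (Subtype.ext_iff.1 h)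
    · exact hwx z hxz (Subtype.ext_iff.1 h)
    · exact hwx z' hxz' (Subtype.ext_iff.1 h)
  have := Set.ncard_le_ncard hsub (Set.toFinite _)
  rw [hH, h3] at this
  omega

/-- In a cubic graph, the neighbours of `x` other than a given one are two in number. -/
theorem exists_other_neighbors (hX : ∀ v, (X.neighborSet v).ncard = 3) {x y : V}
    (hxy : X.Adj x y) : ∃ z z', X.Adj x z ∧ X.Adj x z' ∧ z ≠ y ∧ z' ≠ y ∧ z ≠ z' ∧
      ∀ w, X.Adj x w → w = y ∨ w = z ∨ w = z' := by
  have hmem : y ∈ X.neighborSet x := hxy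
  have h2 : (X.neighborSet x \ {y}).ncard = 2 := by
    rw [Set.ncard_sdiff_singleton_of_mem hmem, hX]
  obtain ⟨z, z', hne, h⟩ := Set.ncard_eq_two.1 h2
  have hz : z ∈ X.neighborSet x \ {y} := by simp [h]
  have hz' : z' ∈ X.neighborSet x \ {y} := by simp [h]
  refine ⟨z, z', hz.1, hz'.1, hz.2, hz'.2, hne, fun w hw => ?_⟩
  by_cases hwy : w = y
  · exact Or.inl hwy
  · have : w ∈ X.neighborSet x \ {y} := ⟨hw, hwy⟩
    rw [h] at this
    exact Or.inr this

theorem exists_adj (hX : ∀ v, (X.neighborSet v).ncard = 3) (x : V) : ∃ y, X.Adj x y :=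
  Set.nonempty_of_ncard_ne_zero (by rw [hX]; norm_num : (X.neighborSet x).ncard ≠ 0)

theorem ncard_neighborSet_lineGraph [Finite V] (hX : ∀ v, (X.neighborSet v).ncard = 3)
    (e : X.edgeSet) : (X.lineGraph.neighborSet e).ncard = 4 := by
  obtain ⟨e, he⟩ := e
  induction e with
  | _ x y =>
  have hxy : X.Adj x y := he
  obtain ⟨z, z', hz, hz', hzy, hzy', hne, hall⟩ := exists_other_neighbors hX hxy
  obtain ⟨w, w', hw, hw', hwx, hwx', hne', hall'⟩ := exists_other_neighbors hX hxy.symm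
  have : X.lineGraph.neighborSet ⟨s(x, y), he⟩ =
      {⟨s(x, z), hz⟩, ⟨s(x, z'), hz'⟩, ⟨s(y, w), hw⟩, ⟨s(y, w'), hw'⟩} := by
    ext f
    constructor
    · intro hf
      obtain ⟨a, b, c, hb, hc, hbc, h1, rfl⟩ := exists_of_lineGraph_adj hf
      have h1 := Subtype.ext_iff.1 h1
      rcases Sym2.eq_iff.1 h1 with ⟨rfl, rfl⟩ | ⟨rfl, rfl⟩
      · rcases hall c hc with rfl | rfl | rfl
        · exact absurd rfl hbc
        · simp
        · simp
      · rcases hall' c hc with rfl | rfl | rfl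
        · exact absurd rfl hbc
        · simp
        · simp
    · have h2 : (⟨s(x, y), he⟩ : X.edgeSet) = ⟨s(y, x), hxy.symm⟩ := Subtype.ext Sym2.eq_swap
      rintro (rfl | rfl | rfl | rfl)
      · exact lineGraph_adj_mk_mk hxy hz hzy.symm
      · exact lineGraph_adj_mk_mk hxy hz' hzy'.symm
      · rw [h2]; exact lineGraph_adj_mk_mk hxy.symm hw hwx.symm
      · rw [h2]; exact lineGraph_adj_mk_mk hxy.symm hw' hwx'.symm
  have hxy' := hxy.ne
  rw [this, Set.ncard_insert_of_notMem, Set.ncard_insert_of_notMem, Set.ncard_pair]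
  all_goals
    simp only [Set.mem_insert_iff, Set.mem_singleton_iff, ne_eq]
    grind

end LineGraph

/-! ### Hamilton decompositions of line graphs of cubic graphs -/

section Kotzig

variable {V : Type*} {X : SimpleGraph V} {H K : SimpleGraph X.edgeSet}

theorem HamiltonPair.joinedAt_right (h : HamiltonPair X.lineGraph H K) {x y z : V}
    (hy : X.Adj x y) (hz : X.Adj x z) (hyz : y ≠ z) (hn : ¬ JoinedAt H x y z) :
    JoinedAt K x y z :=
  ⟨hy, hz, h.right_of_not_left (lineGraph_adj_mk_mk hy hz hyz) fun h' => hn ⟨hy, hz, h'⟩⟩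

theorem HamiltonPair.not_joinedAt (h : HamiltonPair X.lineGraph H K) {x y z : V}
    (hy : JoinedAt H x y z) : ¬ JoinedAt K x y z :=
  fun ⟨_, _, h2⟩ => h.disjoint _ _ hy.2.2 h2

theorem HamiltonPair.le_left {W H K : SimpleGraph V} (h : HamiltonPair W H K) : H ≤ W :=
  fun a b hab => (h.adj_iff a b).2 (Or.inl hab)

/-- The triangle formed in the line graph by the three edges at a vertex is not contained in one
part of a Hamilton pair, for this part would have that triangle as a component. -/
theorem HamiltonPair.not_triangle [Finite V] (hX : ∀ v, (X.neighborSet v).ncard = 3)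
    (h : HamiltonPair X.lineGraph H K) {x y z z' : V} (hyz : y ≠ z) (hyz' : y ≠ z')
    (hzz' : z ≠ z') (h1 : JoinedAt H x y z) (h2 : JoinedAt H x y z') : ¬ JoinedAt H x z z' := by
  intro h3
  obtain ⟨hy, hz, -⟩ := id h1
  obtain ⟨-, hz', -⟩ := id h2
  obtain ⟨a, b, -, -, ha, hb, hab, hall⟩ := exists_other_neighbors hX hy
  have hall : ∀ w, X.Adj x w → w = y ∨ w = z ∨ w = z' := by
    intro w hw
    have := hall w hw
    have := hall z hz
    have := hall z' hz'
    grind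
  have hno : ∀ u w, X.Adj x u → ¬ JoinedAt H u x w := by
    intro u w hu
    rcases hall u hu with rfl | rfl | rfl
    · exact not_joinedAt_of_joinedAt h.ncard_left h1 h2 hzz'
    · exact not_joinedAt_of_joinedAt h.ncard_left h1.symm h3 hyz'
    · exact not_joinedAt_of_joinedAt h.ncard_left h2.symm h3.symm hyz
  have hclosed : ∀ {e f : X.edgeSet}, H.Walk e f → x ∈ (e : Sym2 V) → x ∈ (f : Sym2 V) := by
    intro e f p
    induction p with
    | nil => exact id
    | @cons e f _ hef p ih =>
      intro he
      refine ih ?_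
      obtain ⟨u, v, w, hv, hw, -, rfl, rfl⟩ := exists_of_lineGraph_adj (h.le_left hef)
      rcases Sym2.mem_iff.1 he with rfl | rfl
      · exact Sym2.mem_mk_left _ _
      · exact absurd ⟨hv, hw, hef⟩ (hno u w hv.symm)
  obtain ⟨w, -, hw, -, hwx, -⟩ := exists_other_neighbors hX hy.symm
  obtain ⟨p⟩ := h.connected_left ⟨s(x, y), hy⟩ ⟨s(y, w), hw⟩
  rcases Sym2.mem_iff.1 (hclosed p (Sym2.mem_mk_left _ _)) with h' | h'
  · exact hy.ne h'
  · exact hwx h'.symm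

/-- `IsCenter H K x y` says that, among the three edges at `x`, the edge `xy` is joined to the two
others by `H`, and these two are joined to each other by `K`. -/
structure IsCenter (H K : SimpleGraph X.edgeSet) (x y : V) : Prop where
  adj : X.Adj x y
  left : ∀ z, X.Adj x z → z ≠ y → JoinedAt H x y z
  right : ∀ z z', X.Adj x z → X.Adj x z' → z ≠ y → z' ≠ y → z ≠ z' → JoinedAt K x z z'

/-- At every vertex the three edges have a centre, because two of the three pairs of them belong to
the same part of the Hamilton pair. -/
theorem HamiltonPair.exists_isCenter [Finite V] (hX : ∀ v, (X.neighborSet v).ncard = 3)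
    (h : HamiltonPair X.lineGraph H K) (x : V) : ∃ y, IsCenter H K x y ∨ IsCenter K H x y := by
  have key : ∀ {H K : SimpleGraph X.edgeSet}, HamiltonPair X.lineGraph H K →
      ∀ {a b c : V}, (∀ w, X.Adj x w → w = a ∨ w = b ∨ w = c) → a ≠ b → a ≠ c → b ≠ c →
      JoinedAt H x a b → JoinedAt H x a c → IsCenter H K x a := by
    intro H K h a b c hall hab hac hbc h1 h2
    have hbc' : JoinedAt K x b c :=
      h.joinedAt_right h1.2.1 h2.2.1 hbc (h.not_triangle hX hab hac hbc h1 h2)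
    refine ⟨h1.1, fun z hz hza => ?_, fun z z' hz hz' hza hza' hne => ?_⟩
    · rcases hall z hz with rfl | rfl | rfl
      exacts [absurd rfl hza, h1, h2]
    · rcases hall z hz with rfl | rfl | rfl <;> rcases hall z' hz' with rfl | rfl | rfl
      all_goals first | contradiction | exact hbc' | exact hbc'.symm
  obtain ⟨a, ha⟩ := exists_adj hX x
  obtain ⟨b, c, hb, hc, hba, hca, hbc, hall⟩ := exists_other_neighbors hX ha
  have hallb : ∀ w, X.Adj x w → w = b ∨ w = a ∨ w = c := fun w hw => by have := hall w hw; tauto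
  have hallc : ∀ w, X.Adj x w → w = c ∨ w = a ∨ w = b := fun w hw => by have := hall w hw; tauto
  have nab := h.joinedAt_right ha hb hba.symm
  have nac := h.joinedAt_right ha hc hca.symm
  have nbc := h.joinedAt_right hb hc hbc
  by_cases h1 : JoinedAt H x a b <;> by_cases h2 : JoinedAt H x a c <;>
    by_cases h3 : JoinedAt H x b c
  · exact ⟨a, .inl (key h hall hba.symm hca.symm hbc h1 h2)⟩
  · exact ⟨a, .inl (key h hall hba.symm hca.symm hbc h1 h2)⟩
  · exact ⟨b, .inl (key h hallb hba hbc hca.symm h1.symm h3)⟩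
  · exact ⟨c, .inr (key h.symm hallc hca hbc.symm hba.symm (nac h2).symm (nbc h3).symm)⟩
  · exact ⟨c, .inl (key h hallc hca hbc.symm hba.symm h2.symm h3.symm)⟩
  · exact ⟨b, .inr (key h.symm hallb hba hbc hca.symm (nab h1).symm (nbc h3))⟩
  · exact ⟨a, .inr (key h.symm hall hba.symm hca.symm hbc (nab h1) (nac h2))⟩
  · exact ⟨a, .inr (key h.symm hall hba.symm hca.symm hbc (nab h1) (nac h2))⟩

/-- An edge that is the centre at one end is the centre at the other end, with the parts
exchanged. -/
theorem IsCenter.swap [Finite V] (hX : ∀ v, (X.neighborSet v).ncard = 3)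
    (h : HamiltonPair X.lineGraph H K) {x y : V} (hc : IsCenter H K x y) : IsCenter K H y x := by
  obtain ⟨z, z', hz, hz', hzy, hzy', hne, -⟩ := exists_other_neighbors hX hc.adj
  have hK : ∀ w, X.Adj y w → w ≠ x → JoinedAt K y x w := fun w hw hwx =>
    h.joinedAt_right hc.adj.symm hw hwx.symm <|
      not_joinedAt_of_joinedAt h.ncard_left (hc.left z hz hzy) (hc.left z' hz' hzy') hne
  refine ⟨hc.adj.symm, hK, fun w w' hw hw' hwx hwx' hww => ?_⟩
  exact h.symm.joinedAt_right hw hw' hww <|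
    h.symm.not_triangle hX hwx.symm hwx'.symm hww (hK w hw hwx) (hK w' hw' hwx')

theorem HamiltonPair.isCenter_unique (hX : ∀ v, (X.neighborSet v).ncard = 3)
    (h : HamiltonPair X.lineGraph H K) {x y y' : V} (hc : IsCenter H K x y)
    (hc' : IsCenter H K x y' ∨ IsCenter K H x y') : y = y' := by
  by_contra hne
  rcases hc' with hc' | hc'
  · obtain ⟨z, z', hz, hz', hzy, hzy', hzz, hall⟩ := exists_other_neighbors hX hc.adj
    obtain ⟨t, ht, hty, hty'⟩ : ∃ t, X.Adj x t ∧ t ≠ y ∧ t ≠ y' := by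
      by_cases hzy'' : z = y'
      · exact ⟨z', hz', hzy', fun h => hzz (hzy''.trans h.symm)⟩
      · exact ⟨z, hz, hzy, hzy''⟩
    exact h.not_joinedAt (hc'.left t ht hty')
      (hc.right y' t hc'.adj ht (Ne.symm hne) hty hty'.symm)
  · exact h.not_joinedAt (hc.left y' hc'.adj (Ne.symm hne)) (hc'.left y hc.adj hne).symm

/-- `IsHamiltonMatching X f` says that the map `f` is the involution of a perfect matching of `X`
whose complement is connected; in a cubic graph this complement is then a Hamilton cycle. -/
structure IsHamiltonMatching (X : SimpleGraph V) (f : V → V) : Prop where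
  adj : ∀ x, X.Adj x (f x)
  involutive : Function.Involutive f
  connected : ∀ U : Set V, (∀ x ∈ U, ∀ y, X.Adj x y → y ≠ f x → y ∈ U) →
    ∀ x ∈ U, ∀ y, y ∈ U

/-- If the line graph of a finite cubic graph has a Hamilton decomposition, then the graph is
hamiltonian (Kotzig). -/
theorem HamiltonPair.exists_isHamiltonMatching [Finite V]
    (hX : ∀ v, (X.neighborSet v).ncard = 3) (h : HamiltonPair X.lineGraph H K) :
    ∃ f, IsHamiltonMatching X f := by
  choose f hf using h.exists_isCenter hX
  have huniq : ∀ x y, IsCenter H K x y ∨ IsCenter K H x y → f x = y := by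
    intro x y hy
    rcases hf x with h' | h'
    · exact h.isCenter_unique hX h' hy
    · exact h.symm.isCenter_unique hX h' hy.symm
  have hadj : ∀ x, X.Adj x (f x) := fun x => (hf x).elim (·.adj) (·.adj)
  have hinv : Function.Involutive f := by
    intro x
    refine huniq _ _ ?_
    rcases hf x with h' | h'
    · exact Or.inr (h'.swap hX h)
    · exact Or.inl (h'.swap hX h.symm)
  refine ⟨f, hadj, hinv, fun U hU x hx y => ?_⟩
  by_contra hy
  -- the edges at `U` outside the matching, and the matching edges whose `H`-centred end is in `U`
  let S : Set X.edgeSet := {e | (∃ x ∈ U, ∃ y, X.Adj x y ∧ y ≠ f x ∧ (e : Sym2 V) = s(x, y)) ∨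
    ∃ x ∈ U, IsCenter H K x (f x) ∧ (e : Sym2 V) = s(x, f x)}
  -- the centre edge at a vertex with centre in `H` determines that vertex
  have hcen : ∀ x, IsCenter H K x (f x) → ¬ IsCenter H K (f x) x := by
    intro x h1 h2
    obtain ⟨z, -, hz, -, hzy, -⟩ := exists_other_neighbors hX h2.adj
    exact h.not_joinedAt (h2.left z hz hzy) ((h1.swap hX h).left z hz hzy)
  have hSm : ∀ x (hx : X.Adj x (f x)), IsCenter H K x (f x) →
      (⟨s(x, f x), hx⟩ : X.edgeSet) ∈ S → x ∈ U := by
    rintro x hx hc (⟨a, ha, b, hab, hbf, he⟩ | ⟨a, ha, hca, he⟩)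
    · rcases Sym2.eq_iff.1 he with ⟨rfl, rfl⟩ | ⟨rfl, rfl⟩
      · exact ha
      · exact absurd (hinv x).symm hbf
    · rcases Sym2.eq_iff.1 he with ⟨rfl, -⟩ | ⟨hx1, hx2⟩
      · exact ha
      · subst hx2
        rw [hinv x] at hca
        exact absurd hca (hcen x hc)
  have hSn : ∀ x y (hxy : X.Adj x y), y ≠ f x → (⟨s(x, y), hxy⟩ : X.edgeSet) ∈ S → x ∈ U := by
    rintro x y hxy hne (⟨a, ha, b, hab, hbf, he⟩ | ⟨a, ha, hca, he⟩)
    · rcases Sym2.eq_iff.1 he with ⟨rfl, rfl⟩ | ⟨rfl, rfl⟩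
      · exact ha
      · exact hU _ ha _ hxy.symm hbf
    · rcases Sym2.eq_iff.1 he with ⟨rfl, rfl⟩ | ⟨rfl, rfl⟩
      · exact absurd rfl hne
      · exact absurd (hinv _).symm hne
  have hclosed : ∀ {e e' : X.edgeSet}, H.Walk e e' → e ∈ S → e' ∈ S := by
    intro e e' p
    induction p with
    | nil => exact id
    | @cons e e' _ hee p ih =>
      intro he
      refine ih ?_
      obtain ⟨x, y, z, hy, hz, hyz, rfl, rfl⟩ := exists_of_lineGraph_adj (h.le_left hee)
      have hj : JoinedAt H x y z := ⟨hy, hz, hee⟩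
      rcases hf x with hc | hc
      · by_cases hzf : z = f x
        · subst hzf
          exact Or.inr ⟨x, hSn x y hy hyz he, hc, rfl⟩
        · by_cases hyf : y = f x
          · subst hyf
            exact Or.inl ⟨x, hSm x hy hc he, z, hz, hzf, rfl⟩
          · exact absurd (hc.right y z hy hz hyf hzf hyz) (h.not_joinedAt hj)
      · by_cases hyf : y = f x
        · subst hyf
          exact absurd (hc.left z hz hyz.symm) (h.not_joinedAt hj)
        · by_cases hzf : z = f x
          · subst hzf
            exact absurd (hc.left y hy hyz).symm (h.not_joinedAt hj)
          · exact Or.inl ⟨x, hSn x y hy hyf he, z, hz, hzf, rfl⟩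
  obtain ⟨a, -, ha, -, hax, -⟩ := exists_other_neighbors hX (hadj x)
  obtain ⟨b, -, hb, -, hby, -⟩ := exists_other_neighbors hX (hadj y)
  obtain ⟨p⟩ := h.connected_left ⟨s(x, a), ha⟩ ⟨s(y, b), hb⟩
  exact hy (hSn y b hb hby (hclosed p (Or.inl ⟨x, hx, a, ha, hax, rfl⟩)))

end Kotzig

/-! ### Search through the perfect matchings of a cubic graph -/

section Search

variable {M : Type*} [DecidableEq M]

/-- Breadth-first search with neighbour lists `nb`: from the layer `fr` and the list `vis` of
vertices already seen, `n` further layers are added. -/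
def grow (nb : M → List M) : ℕ → List M → List M → List M
  | 0, _, vis => vis
  | n + 1, fr, vis =>
    let next := (fr.flatMap nb).filter fun q => !vis.elem q
    grow nb n next (next ++ vis)

/-- The neighbour lists that are left when the edges of the matching `m` are deleted; `m` is given as
the list of the pairs of matched vertices, with every edge listed in both directions. -/
def deleteMatching (nb : M → List M) (m : List (M × M)) (p : M) : List M :=
  (nb p).filter fun q => m.lookup p != some q

/-- Whether the vertices found from `p₀` after deletion of the matching `m` are closed under
adjacency and miss some member of `verts`. -/
def disconnects (nb : M → List M) (n : ℕ) (p₀ : M) (verts : List M) (m : List (M × M)) : Bool :=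
  let U := grow (deleteMatching nb m) n [p₀] [p₀]
  U.elem p₀ && U.all (fun p => (deleteMatching nb m p).all fun q => U.elem q) &&
    verts.any fun q => !U.elem q

/-- Backtracking search through the extensions of `m` to a matching that covers all vertices in the
list; the result is `true` if each of them passes the test `leaf`. -/
def checkMatchings (nb : M → List M) (leaf : List (M × M) → Bool) : List M → List (M × M) → Bool
  | [], m => leaf m
  | p :: t, m =>
    if (m.lookup p).isSome then checkMatchings nb leaf t m
    else (nb p).all fun q =>
      (m.lookup q).isSome || checkMatchings nb leaf t ((p, q) :: (q, p) :: m)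

/-- Soundness of the search: at each vertex `p` one of the branches matches `p` with `g p`, so that
some leaf is reached with a list of pairs `(q, g q)`. -/
theorem exists_of_checkMatchings {nb : M → List M} {leaf : List (M × M) → Bool} {g : M → M}
    (hg : Function.Involutive g) (hnb : ∀ p, g p ∈ nb p) :
    ∀ (t : List M) (m : List (M × M)), (∀ q ∈ m, g q.1 = q.2 ∧ q.swap ∈ m) →
      checkMatchings nb leaf t m = true → ∃ m', (∀ q ∈ m', g q.1 = q.2) ∧ leaf m' = true
  | [], m, hm, h => ⟨m, fun q hq => (hm q hq).1, h⟩
  | p :: t, m, hm, h => by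
    rw [checkMatchings] at h
    split_ifs at h with hp
    · exact exists_of_checkMatchings hg hnb t m hm h
    · have h' := List.all_eq_true.1 h (g p) (hnb p)
      rcases Bool.or_eq_true_iff.1 h' with hc | hc
      · -- if `g p` were covered, then so would be its partner `p`
        exfalso
        apply hp
        rw [List.lookup_isSome_iff] at hc ⊢
        obtain ⟨q, hq, hq'⟩ := hc
        obtain ⟨h1, h2⟩ := hm q hq
        rw [← beq_iff_eq.1 hq', hg p] at h1
        exact ⟨q.swap, h2, beq_iff_eq.2 h1⟩
      · refine exists_of_checkMatchings hg hnb t _ (fun q hq => ?_) hc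
        rcases List.mem_cons.1 hq with rfl | hq
        · exact ⟨rfl, by simp⟩
        rcases List.mem_cons.1 hq with rfl | hq
        · exact ⟨hg p, by simp⟩
        · exact ⟨(hm q hq).1, by simp [(hm q hq).2]⟩

theorem exists_set_of_disconnects {nb : M → List M} {n : ℕ} {p₀ : M} {verts : List M}
    {m : List (M × M)} {g : M → M} (hm : ∀ q ∈ m, g q.1 = q.2)
    (h : disconnects nb n p₀ verts m = true) :
    ∃ U : Set M, (∀ p ∈ U, ∀ q ∈ nb p, q ≠ g p → q ∈ U) ∧ p₀ ∈ U ∧ ∃ q, q ∉ U := by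
  simp only [disconnects, Bool.and_eq_true, List.all_eq_true, List.any_eq_true,
    List.elem_eq_mem, decide_eq_true_eq, Bool.not_eq_true', decide_eq_false_iff_not] at h
  obtain ⟨⟨h0, hc⟩, q, -, hq⟩ := h
  refine ⟨{p | p ∈ grow (deleteMatching nb m) n [p₀] [p₀]}, fun p hp q hq hne => ?_, h0, q, hq⟩
  refine hc p hp q (List.mem_filter.2 ⟨hq, bne_iff_ne.2 fun h => hne ?_⟩)
  obtain ⟨l₁, l₂, rfl, -⟩ := List.lookup_eq_some_iff.1 h
  exact (hm (p, q) (by simp)).symm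

variable {V : Type*} {X : SimpleGraph V}

/-- `IsNeighborList X e nb` says that the bijection `e` numbers the vertices of `X`, and that `nb`
lists the three neighbours of every vertex. -/
structure IsNeighborList (X : SimpleGraph V) (e : M ≃ V) (nb : M → List M) : Prop where
  adj_iff : ∀ p q, X.Adj (e p) (e q) ↔ q ∈ nb p
  nodup : ∀ p, (nb p).Nodup
  length : ∀ p, (nb p).length = 3

namespace IsNeighborList

variable {e : M ≃ V} {nb : M → List M}

theorem ncard_neighborSet (h : IsNeighborList X e nb) (v : V) : (X.neighborSet v).ncard = 3 := by
  obtain ⟨p, rfl⟩ := e.surjective v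
  have : X.neighborSet (e p) = e '' ((nb p).toFinset : Set M) := by
    ext w
    obtain ⟨q, rfl⟩ := e.surjective w
    simp [h.adj_iff]
  rw [this, Set.ncard_image_of_injective _ e.injective, Set.ncard_coe_finset,
    List.toFinset_card_of_nodup (h.nodup p), h.length]

theorem connected (h : IsNeighborList X e nb) (n : ℕ) (p₀ : M)
    (hn : ∀ p, p ∈ grow nb n [p₀] [p₀]) : X.Connected := by
  have key : ∀ n fr vis, (∀ p ∈ fr, X.Reachable (e p₀) (e p)) →
      (∀ p ∈ vis, X.Reachable (e p₀) (e p)) →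
      ∀ p ∈ grow nb n fr vis, X.Reachable (e p₀) (e p) := by
    intro n
    induction n with
    | zero => exact fun _ _ _ h => h
    | succ n ih =>
      intro fr vis hfr hvis
      have hnext : ∀ p ∈ (fr.flatMap nb).filter (fun q => !vis.elem q),
          X.Reachable (e p₀) (e p) := by
        intro p hp
        obtain ⟨q, hq, hqp⟩ := List.mem_flatMap.1 (List.mem_filter.1 hp).1
        exact (hfr q hq).trans ((h.adj_iff q p).2 hqp).reachable
      refine ih _ _ hnext fun p hp => ?_
      rcases List.mem_append.1 hp with hp | hp
      exacts [hnext p hp, hvis p hp]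
  have h0 : ∀ v, X.Reachable (e p₀) v := by
    intro v
    obtain ⟨p, rfl⟩ := e.surjective v
    refine key n [p₀] [p₀] ?_ ?_ p (hn p) <;> simp
  have : Nonempty V := ⟨e p₀⟩
  exact ⟨fun v w => (h0 v).symm.trans (h0 w)⟩

theorem not_isHamiltonMatching (h : IsNeighborList X e nb) {n : ℕ} {p₀ : M} {verts : List M}
    (hcheck : checkMatchings nb (disconnects nb n p₀ verts) verts [] = true) (f : V → V) :
    ¬ IsHamiltonMatching X f := by
  intro hf
  have hg : Function.Involutive fun p => e.symm (f (e p)) := fun p => by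
    simp [hf.involutive (e p)]
  have hnb : ∀ p, e.symm (f (e p)) ∈ nb p := fun p => by
    rw [← h.adj_iff, Equiv.apply_symm_apply]
    exact hf.adj (e p)
  obtain ⟨m, hm, hleaf⟩ := exists_of_checkMatchings hg hnb verts [] (by simp) hcheck
  obtain ⟨U, hU, h0, q, hq⟩ := exists_set_of_disconnects (g := fun p => e.symm (f (e p))) hm hleaf
  have := hf.connected (e.symm ⁻¹' U) (fun x hx y hxy hne => hU _ hx _ ?_ ?_) (e p₀) (by simpa)
    (e q)
  · exact hq (by simpa using this)
  · rw [← h.adj_iff]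
    simpa using hxy
  · simpa using hne

end IsNeighborList

end Search

/-! ### The Petersen graph is not hamiltonian -/

section Petersen

/-- The neighbours in the Petersen graph of the vertices `(0, i)`, which stand for the sets
`{i, i + 1}`, and `(1, i)`, which stand for the sets `{i, i + 2}`. -/
def petersenNeighbors : Fin 2 × Fin 5 → List (Fin 2 × Fin 5)
  | (0, i) => [(0, i + 2), (0, i + 3), (1, i + 2)]
  | (1, i) => [(1, i + 1), (1, i + 4), (0, i + 3)]

/-- The `2`-subset of the `5`-set for which a pair of indices stands. -/
def petersenPair (p : Fin 2 × Fin 5) : Finset (Fin 5) :=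
  {p.2, p.2 + 1 + p.1.castLE (by decide)}

noncomputable def petersenEquiv : Fin 2 × Fin 5 ≃ {s : Finset (Fin 5) // s.card = 2} :=
  Equiv.ofBijective (fun p => ⟨petersenPair p, by revert p; decide +kernel⟩) (by decide +kernel)

theorem petersen_isNeighborList :
    IsNeighborList petersenGraph petersenEquiv petersenNeighbors where
  adj_iff := by
    have : ∀ p q, Disjoint (petersenPair p) (petersenPair q) ↔ q ∈ petersenNeighbors p := by
      decide +kernel
    exact this
  nodup := by decide +kernel
  length := by decide +kernel

theorem petersenGraph_connected : petersenGraph.Connected :=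
  petersen_isNeighborList.connected 2 (0, 0) (by decide +kernel)

theorem not_isHamiltonMatching_petersenGraph (f) : ¬ IsHamiltonMatching petersenGraph f :=
  petersen_isNeighborList.not_isHamiltonMatching (n := 3) (p₀ := (0, 0))
    (verts := (List.finRange 2).product (List.finRange 5)) (by decide +kernel) f

end Petersen

/-! ### The Coxeter graph is not hamiltonian -/

section Coxeter

/-- The neighbours in the Coxeter graph. The vertices `(0, i)` stand for the triples
`{i + 3, i + 5, i + 6}`, and the vertices `(k, i)` with `k = 1, 2, 3` stand for the triples
`{i, i + 2 ^ (k - 1), i + 2 ^ k}` modulo `7`. -/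
def coxeterNeighbors : Fin 4 × Fin 7 → List (Fin 4 × Fin 7)
  | (0, i) => [(1, i), (2, i), (3, i)]
  | (1, i) => [(0, i), (1, i + 3), (1, i + 4)]
  | (2, i) => [(0, i), (2, i + 6), (2, i + 1)]
  | (3, i) => [(0, i), (3, i + 5), (3, i + 2)]

/-- The triple of points of the Fano plane for which a pair of indices stands. -/
def coxeterTriple : Fin 4 × Fin 7 → Finset (Fin 7)
  | (0, i) => {i + 3, i + 5, i + 6}
  | (1, i) => {i, i + 1, i + 2}
  | (2, i) => {i, i + 2, i + 4}
  | (3, i) => {i, i + 4, i + 1}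

noncomputable def coxeterEquiv : Fin 4 × Fin 7 ≃
    {s : Finset (Fin 7) // s.card = 3 ∧ ∀ i : Fin 7, s ≠ {i, i + 1, i + 3}} :=
  Equiv.ofBijective (fun p => ⟨coxeterTriple p, by revert p; decide +kernel⟩)
    ((Fintype.bijective_iff_injective_and_card _).2 ⟨by decide +kernel, by decide +kernel⟩)

theorem coxeter_isNeighborList :
    IsNeighborList coxeterGraph coxeterEquiv coxeterNeighbors where
  adj_iff := by
    have : ∀ p q, Disjoint (coxeterTriple p) (coxeterTriple q) ↔ q ∈ coxeterNeighbors p := by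
      decide +kernel
    exact this
  nodup := by decide +kernel
  length := by decide +kernel

theorem coxeterGraph_connected : coxeterGraph.Connected :=
  coxeter_isNeighborList.connected 4 (0, 0) (by decide +kernel)

theorem not_isHamiltonMatching_coxeterGraph (f) : ¬ IsHamiltonMatching coxeterGraph f :=
  coxeter_isNeighborList.not_isHamiltonMatching (n := 7) (p₀ := (0, 0))
    -- the order of the vertices matters only for the size of the search tree
    (verts := (List.finRange 7).flatMap fun i => (List.finRange 4).map fun k => (k, i))
    (by decide +kernel) f

end Coxeter

/-! ### Connectivity, valency and automorphisms of arc graphs -/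

section ArcGraph

variable {V : Type*} {Y : SimpleGraph V}

theorem arcGraph_connected (hY : Y.Connected) (hex : ∀ u, ∃ v, Y.Adj u v) :
    (arcGraph Y).Connected := by
  have same : ∀ a b : Y.Dart, a.fst = b.fst → (arcGraph Y).Reachable a b := by
    intro a b hab
    by_cases h : a = b
    · rw [h]
    · exact SimpleGraph.Adj.reachable (Or.inl ⟨h, hab⟩)
  have key : ∀ {u v : V}, Y.Walk u v → ∀ a b : Y.Dart, a.fst = u → b.fst = v →
      (arcGraph Y).Reachable a b := by
    intro u v p
    induction p with
    | nil => exact fun a b ha hb => same a b (ha.trans hb.symm)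
    | @cons u w v h p ih =>
      intro a b ha hb
      have h1 := same a ⟨(u, w), h⟩ ha
      have h2 : (arcGraph Y).Adj ⟨(u, w), h⟩ (SimpleGraph.Dart.symm ⟨(u, w), h⟩) := Or.inr rfl
      exact (h1.trans h2.reachable).trans (ih _ b rfl hb)
  obtain ⟨u⟩ := hY.nonempty
  obtain ⟨v, huv⟩ := hex u
  have : Nonempty Y.Dart := ⟨⟨(u, v), huv⟩⟩
  refine ⟨fun a b => ?_⟩
  obtain ⟨p⟩ := hY.preconnected a.fst b.fst
  exact key p a b rfl rfl

theorem lineGraph_connected {X : SimpleGraph V} (hX : X.Connected) (hex : ∀ u, ∃ v, X.Adj u v) :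
    X.lineGraph.Connected := by
  have same : ∀ (x : V) (e f : X.edgeSet), x ∈ (e : Sym2 V) → x ∈ (f : Sym2 V) →
      X.lineGraph.Reachable e f := by
    intro x e f he hf
    by_cases h : e = f
    · rw [h]
    · exact SimpleGraph.Adj.reachable (SimpleGraph.lineGraph_adj_iff_exists.2 ⟨h, x, he, hf⟩)
  have key : ∀ {u v : V}, X.Walk u v → ∀ e f : X.edgeSet, u ∈ (e : Sym2 V) → v ∈ (f : Sym2 V) →
      X.lineGraph.Reachable e f := by
    intro u v p
    induction p with
    | nil => exact same _
    | @cons u w v h p ih =>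
      intro e f he hf
      exact (same u e ⟨s(u, w), h⟩ he (Sym2.mem_mk_left _ _)).trans
        (ih _ f (Sym2.mem_mk_right _ _) hf)
  obtain ⟨u⟩ := hX.nonempty
  obtain ⟨v, huv⟩ := hex u
  have : Nonempty X.edgeSet := ⟨⟨s(u, v), huv⟩⟩
  refine ⟨fun e f => ?_⟩
  obtain ⟨p⟩ := hX.preconnected e.1.out.1 f.1.out.1
  exact key p e f (Sym2.out_fst_mem _) (Sym2.out_fst_mem _)

/-- The arcs adjacent to `a` are its reverse and the other arcs with the same initial vertex, so
`arcGraph Y` has the same valency as `Y`. -/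
theorem ncard_neighborSet_arcGraph [Finite V] (a : Y.Dart) :
    ((arcGraph Y).neighborSet a).ncard = (Y.neighborSet a.fst).ncard := by
  let φ : Y.neighborSet a.fst → Y.Dart := fun v =>
    open Classical in if v.1 = a.snd then a.symm else ⟨(a.fst, v.1), v.2⟩
  have hφ : Function.Injective φ := by
    rintro ⟨v, hv⟩ ⟨w, hw⟩ h
    apply Subtype.ext
    by_cases h1 : v = a.snd <;> by_cases h2 : w = a.snd <;> simp only [φ, h1, h2, if_true, if_false]
      at h
    · exact h1.trans h2.symm
    · exact absurd (congrArg (fun d : Y.Dart => d.fst) h) a.adj.ne'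
    · exact absurd (congrArg (fun d : Y.Dart => d.fst) h) a.adj.ne
    · exact congrArg (fun d : Y.Dart => d.snd) h
  have himg : (arcGraph Y).neighborSet a = Set.range φ := by
    ext b
    constructor
    · rintro (⟨hne, hab⟩ | rfl)
      · have hb : b.snd ≠ a.snd := fun h =>
          hne (SimpleGraph.Dart.ext _ _ (Prod.ext hab h.symm))
        refine ⟨⟨b.snd, by rw [hab]; exact b.adj⟩, ?_⟩
        simp only [φ, hb, if_false]
        exact SimpleGraph.Dart.ext _ _ (Prod.ext hab rfl)
      · exact ⟨⟨a.snd, a.adj⟩, by simp [φ]⟩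
    · rintro ⟨⟨v, hv⟩, rfl⟩
      by_cases h : v = a.snd
      · exact Or.inr (by simp [φ, h])
      · refine Or.inl ⟨fun h' => h ?_, ?_⟩
        · simp only [φ, h, if_false] at h'
          exact (congrArg (fun d : Y.Dart => d.snd) h').symm
        · simp [φ, h]
  rw [himg, ← Set.image_univ, Set.ncard_image_of_injective _ hφ, Set.ncard_univ,
    Nat.card_coe_set_eq]

/-- An automorphism of a graph induces an automorphism of its arc graph. -/
def arcGraphAut (Y : SimpleGraph V) : (Y ≃g Y) →* (arcGraph Y ≃g arcGraph Y) where
  toFun f :=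
    { toFun := fun d => ⟨(f d.fst, f d.snd), f.map_rel_iff.2 d.adj⟩
      invFun := fun d => ⟨(f.symm d.fst, f.symm d.snd), f.symm.map_rel_iff.2 d.adj⟩
      left_inv := fun d => by simp
      right_inv := fun d => by simp
      map_rel_iff' := fun {a b} => by
        simp only [arcGraph, Equiv.coe_fn_mk, SimpleGraph.Dart.ext_iff, Prod.ext_iff, ne_eq,
          SimpleGraph.Dart.symm_mk, Prod.fst_swap, Prod.snd_swap, EmbeddingLike.apply_eq_iff_eq]
        rfl }
  map_one' := rfl
  map_mul' _ _ := rfl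

/-- An automorphism of a graph induces an automorphism of its line graph. -/
def lineGraphAut (X : SimpleGraph V) : (X ≃g X) →* (X.lineGraph ≃g X.lineGraph) where
  toFun f := SimpleGraph.Iso.lineGraph f
  map_one' := by
    refine RelIso.ext fun e => Subtype.ext ?_
    exact congrFun Sym2.map_id _
  map_mul' f g := by
    refine RelIso.ext fun e => Subtype.ext ?_
    exact (Sym2.map_map (f := g) (g := f) e.1).symm

end ArcGraph

/-! ### Regular actions on `2`-arcs -/

section Cayley

variable {V Γ : Type*} [Group Γ] {X : SimpleGraph V}

/-- A graph with a group of automorphisms that acts regularly on its vertices is a Cayley graph on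
this group (Sabidussi). -/
theorem isCayleyGraphOn_of_bijective (φ : Γ →* (X ≃g X)) (v : V)
    (hφ : Function.Bijective fun g => φ g v) : IsCayleyGraphOn X Γ := by
  have hadj : ∀ g h : Γ, X.Adj (φ g v) (φ h v) ↔ X.Adj v (φ (g⁻¹ * h) v) := by
    intro g h
    rw [← (φ g).map_adj_iff (v := v), ← RelIso.mul_apply, ← map_mul, mul_inv_cancel_left]
  refine ⟨{g | X.Adj v (φ g v)}, fun h => ?_, fun g hg => ?_, ⟨RelIso.symm ⟨Equiv.ofBijective _ hφ,
    fun {g h} => ?_⟩⟩⟩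
  · rw [Set.mem_ofPred_eq, map_one] at h
    exact X.loopless.irrefl v h
  · have := (hadj g 1).1 (by rw [map_one]; exact hg.symm)
    rwa [mul_one] at this
  · simp only [Equiv.ofBijective_apply, SimpleGraph.mulCayley_adj, Set.mem_ofPred_eq]
    rw [← hadj, ← hadj]
    exact ⟨fun h => ⟨fun h' => h.ne (by rw [h']), Or.inl h⟩,
      fun h => h.2.elim id SimpleGraph.Adj.symm⟩

theorem card_dart_eq [Finite V] {k : ℕ} (hX : ∀ v, (X.neighborSet v).ncard = k) :
    Nat.card X.Dart = k * Nat.card V := by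
  classical
  have := Fintype.ofFinite V
  have hdeg : ∀ v, X.degree v = k := fun v => by
    rw [← hX v, ← SimpleGraph.card_neighborSet_eq_degree, ← Nat.card_eq_fintype_card,
      Nat.card_coe_set_eq]
  rw [Nat.card_eq_fintype_card, X.dart_card_eq_sum_degrees, Finset.sum_congr rfl fun v _ => hdeg v]
  simp [mul_comm]

theorem two_mul_card_edgeSet [Finite V] : 2 * Nat.card X.edgeSet = Nat.card X.Dart := by
  classical
  have := Fintype.ofFinite V
  rw [Nat.card_eq_fintype_card, Nat.card_eq_fintype_card, X.dart_card_eq_twice_card_edges,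
    SimpleGraph.edgeFinset_card]

/-- The arcs of the line graph of a cubic graph are its `2`-arcs. Hence, if a group of automorphisms
has as many elements as there are `2`-arcs and only its identity fixes a certain `2`-arc, then this
group acts regularly on them. -/
theorem isCayleyGraphOn_arcGraph_lineGraph [Finite V] (hX : ∀ v, (X.neighborSet v).ncard = 3)
    (φ : Γ →* (X ≃g X)) (hcard : Nat.card Γ = 6 * Nat.card V) {x y z : V} (hy : X.Adj x y)
    (hz : X.Adj x z) (hyz : y ≠ z)
    (hstab : ∀ g, φ g x = x → φ g y = y → φ g z = z → g = 1) :
    IsCayleyGraphOn (arcGraph X.lineGraph) Γ := by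
  refine isCayleyGraphOn_of_bijective ((arcGraphAut _).comp ((lineGraphAut X).comp φ))
    ⟨(⟨s(x, y), hy⟩, ⟨s(x, z), hz⟩), lineGraph_adj_mk_mk hy hz hyz⟩ ?_
  have : Finite X.lineGraph.Dart := Finite.of_injective _ SimpleGraph.Dart.toProd_injective
  rw [Nat.bijective_iff_injective_and_card]
  constructor
  · intro g h hgh
    have h1 : s(φ g x, φ g y) = s(φ h x, φ h y) :=
      congrArg (fun d : X.lineGraph.Dart => (d.fst : Sym2 V)) hgh
    have h2 : s(φ g x, φ g z) = s(φ h x, φ h z) :=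
      congrArg (fun d : X.lineGraph.Dart => (d.snd : Sym2 V)) hgh
    have h3 : φ g x = φ h x ∧ φ g y = φ h y ∧ φ g z = φ h z := by
      have := (φ g).injective.ne hyz
      have := (φ g).injective.ne hy.ne
      have := (φ g).injective.ne hz.ne
      rw [Sym2.eq_iff] at h1 h2
      grind
    have key : ∀ t, φ g t = φ h t → φ (h⁻¹ * g) t = t := by
      intro t ht
      rw [map_mul, RelIso.mul_apply, ht, ← RelIso.mul_apply, ← map_mul, inv_mul_cancel, map_one]
      rfl
    exact (inv_mul_eq_one.1 (hstab _ (key x h3.1) (key y h3.2.1) (key z h3.2.2))).symm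
  · have h1 := two_mul_card_edgeSet (X := X)
    rw [card_dart_eq hX] at h1
    rw [card_dart_eq (ncard_neighborSet_lineGraph hX), hcard]
    omega

end Cayley

/-! ### The arc graph of the line graph of a cubic graph -/

section Main

variable {V : Type*} {X : SimpleGraph V}

theorem nontrivial_edgeSet (hX : ∀ v, (X.neighborSet v).ncard = 3) [Nonempty V] :
    Nontrivial X.edgeSet := by
  obtain ⟨y, hy⟩ := exists_adj hX (Classical.arbitrary V)
  obtain ⟨z, -, hz, -, hzy, -⟩ := exists_other_neighbors hX hy
  exact ⟨_, _, (lineGraph_adj_mk_mk hz hy hzy).ne⟩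

theorem connected_arcGraph_lineGraph (hX : ∀ v, (X.neighborSet v).ncard = 3)
    (hconn : X.Connected) : (arcGraph X.lineGraph).Connected := by
  have := hconn.nonempty
  have := nontrivial_edgeSet hX
  have hL := lineGraph_connected hconn (exists_adj hX)
  refine arcGraph_connected hL fun e => ?_
  obtain ⟨f, hf⟩ := exists_ne e
  obtain ⟨p⟩ := hL.preconnected e f
  cases p with
  | nil => exact absurd rfl hf
  | cons h p => exact ⟨_, h⟩

theorem isRegularOfDegree_arcGraph_lineGraph [Finite V] [(arcGraph X.lineGraph).LocallyFinite]
    (hX : ∀ v, (X.neighborSet v).ncard = 3) :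
    (arcGraph X.lineGraph).IsRegularOfDegree 4 := by
  intro a
  rw [← SimpleGraph.card_neighborSet_eq_degree, ← Nat.card_eq_fintype_card, Nat.card_coe_set_eq,
    ncard_neighborSet_arcGraph, ncard_neighborSet_lineGraph hX]

theorem not_hasHamiltonDecomposition_arcGraph_lineGraph [Finite V]
    [DecidableEq X.lineGraph.Dart] [(arcGraph X.lineGraph).LocallyFinite]
    (hX : ∀ v, (X.neighborSet v).ncard = 3) (hconn : X.Connected)
    (hno : ∀ f, ¬ IsHamiltonMatching X f) :
    ¬ HasHamiltonDecomposition (arcGraph X.lineGraph) := by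
  intro h
  have := hconn.nonempty
  have := nontrivial_edgeSet hX
  have := (connected_arcGraph_lineGraph hX hconn).nonempty
  obtain ⟨H, K, hHK⟩ := h.exists_hamiltonPair (isRegularOfDegree_arcGraph_lineGraph hX)
  obtain ⟨f, hf⟩ :=
    (hHK.of_arcGraph (ncard_neighborSet_lineGraph hX)).exists_isHamiltonMatching hX
  exact hno f hf

end Main

/-! ### The action of `Alt(5)` on the Petersen graph -/

section AlternatingGroup

/-- The action of the permutations of the `5`-set on the Petersen graph. -/
def petersenAut : Equiv.Perm (Fin 5) →* (petersenGraph ≃g petersenGraph) where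
  toFun g :=
    { toFun := fun s => ⟨s.1.map g.toEmbedding, (Finset.card_map _).trans s.2⟩
      invFun := fun s => ⟨s.1.map g.symm.toEmbedding, (Finset.card_map _).trans s.2⟩
      left_inv := fun s => Subtype.ext (by simp [Finset.map_map])
      right_inv := fun s => Subtype.ext (by simp [Finset.map_map])
      map_rel_iff' := Finset.disjoint_map _ }
  map_one' := RelIso.ext fun s => Subtype.ext (Finset.map_refl)
  map_mul' g h := RelIso.ext fun s => Subtype.ext (Finset.map_map h.toEmbedding g.toEmbedding _).symm

theorem card_petersen_vertices : Nat.card {s : Finset (Fin 5) // s.card = 2} = 10 := by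
  rw [← Nat.card_congr petersenEquiv]
  simp

theorem isCayleyGraphOn_petersen :
    IsCayleyGraphOn (arcGraph petersenGraph.lineGraph) (alternatingGroup (Fin 5)) := by
  have hstab : ∀ g : Equiv.Perm (Fin 5),
      ({2, 3} : Finset (Fin 5)).map g.toEmbedding = {2, 3} →
      ({0, 1} : Finset (Fin 5)).map g.toEmbedding = {0, 1} →
      ({0, 4} : Finset (Fin 5)).map g.toEmbedding = {0, 4} →
      Equiv.Perm.sign g = 1 → g = 1 := by
    decide +kernel
  refine isCayleyGraphOn_arcGraph_lineGraph petersen_isNeighborList.ncard_neighborSet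
    (petersenAut.comp (alternatingGroup (Fin 5)).subtype) ?_ (x := ⟨{2, 3}, rfl⟩)
    (y := ⟨{0, 1}, rfl⟩) (z := ⟨{0, 4}, rfl⟩) (by decide) (by decide) (by decide)
    fun g hx hy hz => Subtype.ext ?_
  · rw [card_petersen_vertices, nat_card_alternatingGroup]
    simp [Nat.factorial]
  · exact hstab g (Subtype.ext_iff.1 hx) (Subtype.ext_iff.1 hy) (Subtype.ext_iff.1 hz) g.2

end AlternatingGroup

/-! ### The action of `PSL(2,7)` on the Coxeter graph -/

section ProjectiveSpecialLinearGroup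

open Matrix

instance : Fact (Nat.Prime 7) := ⟨by norm_num⟩

/-- The special linear group is the kernel of the determinant, which maps the general linear group
of order `2016` onto a group of order `6`. -/
theorem card_SL_two_seven : Nat.card (SpecialLinearGroup (Fin 2) (ZMod 7)) = 336 := by
  have hker : (GeneralLinearGroup.det : GL (Fin 2) (ZMod 7) →* (ZMod 7)ˣ).ker =
      (SpecialLinearGroup.toGL : SpecialLinearGroup (Fin 2) (ZMod 7) →* _).range := by
    ext A
    rw [MonoidHom.mem_ker, MonoidHom.mem_range]
    constructor
    · intro h
      exact ⟨⟨A.1, congrArg Units.val h⟩, Units.ext rfl⟩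
    · rintro ⟨B, rfl⟩
      exact Units.ext B.2
  have h1 := Subgroup.card_mul_index
    (GeneralLinearGroup.det : GL (Fin 2) (ZMod 7) →* (ZMod 7)ˣ).ker
  rw [Subgroup.index_ker, MonoidHom.range_eq_top.2 GeneralLinearGroup.det_surjective,
    Subgroup.card_top, card_GL_field, hker,
    ← Nat.card_congr (MonoidHom.ofInjective SpecialLinearGroup.toGL_injective).toEquiv,
    Nat.card_eq_fintype_card (α := (ZMod 7)ˣ), ZMod.card_units] at h1
  simp [Fin.prod_univ_two, ZMod.card, -Nat.card_eq_fintype_card] at h1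
  omega

theorem card_PSL_two_seven : Nat.card (ProjectiveSpecialLinearGroup (Fin 2) (ZMod 7)) = 168 := by
  have h1 := Subgroup.card_eq_card_quotient_mul_card_subgroup
    (Subgroup.center (SpecialLinearGroup (Fin 2) (ZMod 7)))
  have h2 : Nat.card (Subgroup.center (SpecialLinearGroup (Fin 2) (ZMod 7))) = 2 := by
    rw [Nat.card_congr (SpecialLinearGroup.center_equiv_rootsOfUnity' 0).toEquiv, Fintype.card_fin]
    exact (IsPrimitiveRoot.neg_one 7 (by norm_num)).card_rootsOfUnity
  rw [card_SL_two_seven, h2] at h1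
  change 336 = Nat.card (ProjectiveSpecialLinearGroup (Fin 2) (ZMod 7)) * 2 at h1
  omega

/-- The symmetric `2 × 2` matrices of determinant `-1` over `ZMod 7`. They describe the binary
quadratic forms that have two distinct zeros on the projective line, normalized up to sign. -/
abbrev SplitForm : Type :=
  {Q : Matrix (Fin 2) (Fin 2) (ZMod 7) // Q.IsSymm ∧ Q.det = -1}

/-- Identification of a form with its negative. -/
def SplitForm.setoid : Setoid SplitForm where
  r Q R := Q.1 = R.1 ∨ Q.1 = -R.1
  iseqv :=
    { refl := fun _ => Or.inl rfl
      symm := by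
        rintro Q R (h | h)
        · exact Or.inl h.symm
        · exact Or.inr (by rw [h, neg_neg])
      trans := by
        rintro Q R S (h | h) (h' | h') <;> simp [h, h'] }

/-- Pairs of points of the projective line over the field with seven elements, each given by the
split forms that vanish on it. -/
abbrev PointPair : Type := Quotient SplitForm.setoid

theorem det_add_neg (Q R : SplitForm) (h : (Q.1 + R.1).det = -2) : (Q.1 + -R.1).det = -2 := by
  have hQ := Q.2.2
  have hR := R.2.2
  simp only [det_fin_two, Matrix.add_apply, Matrix.neg_apply] at hQ hR h ⊢
  linear_combination 2 * hQ + 2 * hR - h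

/-- The graph on the pairs of points in which harmonic pairs are adjacent. Two pairs are harmonic if
their forms are orthogonal for the polar form of the determinant, that is, if the determinant is
additive on them; this does not change when one form is replaced by its negative. -/
def harmonicGraph : SimpleGraph PointPair where
  Adj := Quotient.lift₂ (fun Q R => (Q.1 + R.1).det = -2) <| by
    have key : ∀ Q R R' : SplitForm, (R.1 = R'.1 ∨ R.1 = -R'.1) → (Q.1 + R.1).det = -2 →
        (Q.1 + R'.1).det = -2 := by
      rintro Q R R' (h | h) hQ
      · rwa [← h]
      · have := det_add_neg Q R hQ
        rwa [h, neg_neg] at this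
    intro Q R Q' R' hQ hR
    refine propext ⟨fun h => ?_, fun h => ?_⟩
    · have := key Q R R' hR h
      rw [add_comm] at this ⊢
      exact key R' Q Q' hQ this
    · have := key Q' R' R (SplitForm.setoid.symm hR) h
      rw [add_comm] at this ⊢
      exact key R Q' Q (SplitForm.setoid.symm hQ) this
  symm := ⟨by
    rintro ⟨Q⟩ ⟨R⟩ (h : (Q.1 + R.1).det = -2)
    change (R.1 + Q.1).det = -2
    rwa [add_comm]⟩
  loopless := ⟨by
    rintro ⟨Q, -, hQ⟩ (h : (Q + Q).det = -2)
    rw [det_fin_two] at hQ h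
    simp only [Matrix.add_apply] at h
    have h2 : (2 : ZMod 7) = 0 := by linear_combination 4 * hQ - h
    exact absurd h2 (by decide)⟩

/-- The congruence `Q ↦ g Q gᵀ` as a map on pairs of points. -/
def pointPairMap (g : SpecialLinearGroup (Fin 2) (ZMod 7)) : PointPair → PointPair :=
  @Quotient.map _ _ SplitForm.setoid SplitForm.setoid
    (fun Q => ⟨g.1 * Q.1 * g.1ᵀ, by
      rw [IsSymm, transpose_mul, transpose_mul, transpose_transpose, Q.2.1.eq, Matrix.mul_assoc],
      by rw [det_mul, det_mul, det_transpose, g.2, Q.2.2]; norm_num⟩) <| by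
    rintro Q R (h | h)
    · exact Or.inl (by simp only [h])
    · exact Or.inr (by simp only [h, Matrix.mul_neg, Matrix.neg_mul])

theorem pointPairMap_one (v : PointPair) : pointPairMap 1 v = v := by
  obtain ⟨Q⟩ := v
  refine congrArg (Quotient.mk _) (Subtype.ext ?_)
  simp

theorem pointPairMap_mul (g h : SpecialLinearGroup (Fin 2) (ZMod 7)) (v : PointPair) :
    pointPairMap (g * h) v = pointPairMap g (pointPairMap h v) := by
  obtain ⟨Q⟩ := v
  refine congrArg (Quotient.mk _) (Subtype.ext ?_)
  simp [Matrix.mul_assoc]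

/-- The action of the special linear group on the graph of harmonic pairs. -/
def harmonicAut :
    SpecialLinearGroup (Fin 2) (ZMod 7) →* (harmonicGraph ≃g harmonicGraph) where
  toFun g :=
    { toFun := pointPairMap g
      invFun := pointPairMap g⁻¹
      left_inv := fun v => by rw [← pointPairMap_mul, inv_mul_cancel, pointPairMap_one]
      right_inv := fun v => by rw [← pointPairMap_mul, mul_inv_cancel, pointPairMap_one]
      map_rel_iff' := by
        rintro ⟨Q⟩ ⟨R⟩
        change (g.1 * Q.1 * g.1ᵀ + g.1 * R.1 * g.1ᵀ).det = -2 ↔ (Q.1 + R.1).det = -2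
        rw [← Matrix.add_mul, ← Matrix.mul_add, det_mul, det_mul, det_transpose, g.2, one_mul,
          mul_one] }
  map_one' := RelIso.ext pointPairMap_one
  map_mul' g h := RelIso.ext (pointPairMap_mul g h)

theorem center_le_ker_harmonicAut :
    Subgroup.center (SpecialLinearGroup (Fin 2) (ZMod 7)) ≤ harmonicAut.ker := by
  intro g hg
  obtain ⟨r, hr, hg⟩ := Matrix.SpecialLinearGroup.mem_center_iff.1 hg
  rw [Fintype.card_fin] at hr
  refine RelIso.ext ?_
  rintro ⟨Q⟩
  refine congrArg (Quotient.mk _) (Subtype.ext ?_)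
  change g.1 * Q.1 * g.1ᵀ = Q.1
  rw [← hg, scalar_apply, diagonal_transpose, ← smul_one_eq_diagonal]
  simp [smul_smul, ← pow_two, hr]

/-- The form attached to a vertex of the Coxeter graph: `(0, i)` corresponds to the pair `{∞, i}`,
and `(k, i)` corresponds to the pair `{i - s, i + s}` with `s = 2 ^ (k - 1)`. -/
def vertexForm : Fin 4 × Fin 7 → ZMod 7 × ZMod 7 × ZMod 7
  | (0, i) => (0, 1, -2 * i.val)
  | (1, i) => (1, -i.val, i.val ^ 2 - 1)
  | (2, i) => (4, -4 * i.val, 4 * i.val ^ 2 - 2)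
  | (3, i) => (2, -2 * i.val, 2 * i.val ^ 2 - 4)

/-- The symmetric matrix with the entries `a`, `b`, `c`. -/
def symmMatrix (t : ZMod 7 × ZMod 7 × ZMod 7) : Matrix (Fin 2) (Fin 2) (ZMod 7) :=
  !![t.1, t.2.1; t.2.1, t.2.2]

theorem det_symmMatrix (t : ZMod 7 × ZMod 7 × ZMod 7) :
    (symmMatrix t).det = t.1 * t.2.2 - t.2.1 * t.2.1 := by
  simp [symmMatrix]

theorem symmMatrix_add (t u : ZMod 7 × ZMod 7 × ZMod 7) :
    symmMatrix t + symmMatrix u = symmMatrix (t + u) := by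
  ext i j
  fin_cases i <;> fin_cases j <;> rfl

theorem symmMatrix_neg (t : ZMod 7 × ZMod 7 × ZMod 7) : -symmMatrix t = symmMatrix (-t) := by
  ext i j
  fin_cases i <;> fin_cases j <;> rfl

theorem symmMatrix_injective : Function.Injective symmMatrix := fun _ _ h =>
  Prod.ext (congrFun (congrFun h 0) 0)
    (Prod.ext (congrFun (congrFun h 0) 1) (congrFun (congrFun h 1) 1))

/-- The symmetric matrix with the entries `vertexForm p`, as a split form. -/
def vertexSplitForm (p : Fin 4 × Fin 7) : SplitForm :=
  ⟨symmMatrix (vertexForm p), by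
    refine Matrix.ext fun i j => ?_
    fin_cases i <;> fin_cases j <;> rfl, by
    rw [det_symmMatrix]; revert p; decide +kernel⟩

/-- The pair of points that corresponds to a vertex of the Coxeter graph. -/
def vertexPair (p : Fin 4 × Fin 7) : PointPair := Quotient.mk _ (vertexSplitForm p)

theorem vertexPair_bijective : Function.Bijective vertexPair := by
  constructor
  · intro p q h
    have h' : symmMatrix (vertexForm p) = symmMatrix (vertexForm q) ∨
        symmMatrix (vertexForm p) = -symmMatrix (vertexForm q) := Quotient.exact h
    rw [symmMatrix_neg, symmMatrix_injective.eq_iff, symmMatrix_injective.eq_iff] at h'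
    clear h
    revert p q
    decide +kernel
  · rintro ⟨Q, hs, hd⟩
    have hall : ∀ a b c : ZMod 7, a * c - b * b = -1 →
        ∃ p, vertexForm p = (a, b, c) ∨ vertexForm p = -(a, b, c) := by
      decide +kernel
    have hQ : Q = symmMatrix (Q 0 0, Q 0 1, Q 1 1) := by
      refine Matrix.ext fun i j => ?_
      fin_cases i <;> fin_cases j <;> first | rfl | exact hs.apply 0 1
    rw [hQ, det_symmMatrix] at hd
    obtain ⟨p, hp⟩ := hall _ _ _ hd
    refine ⟨p, Quotient.sound ?_⟩
    change symmMatrix (vertexForm p) = Q ∨ symmMatrix (vertexForm p) = -Q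
    rw [hQ, symmMatrix_neg, symmMatrix_injective.eq_iff, symmMatrix_injective.eq_iff]
    exact hp

theorem harmonicGraph_adj_vertexPair (p q : Fin 4 × Fin 7) :
    harmonicGraph.Adj (vertexPair p) (vertexPair q) ↔ q ∈ coxeterNeighbors p := by
  change (symmMatrix (vertexForm p) + symmMatrix (vertexForm q)).det = -2 ↔ _
  rw [symmMatrix_add, det_symmMatrix]
  revert p q
  decide +kernel

/-- The Coxeter graph is the graph of harmonic pairs of points of the projective line over the field
with seven elements. -/
noncomputable def coxeterIso : coxeterGraph ≃g harmonicGraph where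
  toEquiv := coxeterEquiv.symm.trans (Equiv.ofBijective _ vertexPair_bijective)
  map_rel_iff' {s t} := by
    obtain ⟨p, rfl⟩ := coxeterEquiv.surjective s
    obtain ⟨q, rfl⟩ := coxeterEquiv.surjective t
    rw [coxeter_isNeighborList.adj_iff, ← harmonicGraph_adj_vertexPair]
    simp

/-- The action of the projective special linear group on the Coxeter graph. -/
noncomputable def coxeterAut :
    ProjectiveSpecialLinearGroup (Fin 2) (ZMod 7) →* (coxeterGraph ≃g coxeterGraph) :=
  MonoidHom.comp
    { toFun := fun f => (coxeterIso.trans f).trans coxeterIso.symm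
      map_one' := RelIso.ext fun v => coxeterIso.symm_apply_apply v
      map_mul' := fun f g => RelIso.ext fun v => by
        simp [RelIso.mul_apply] }
    (QuotientGroup.lift _ harmonicAut center_le_ker_harmonicAut)

/-- The entries of `g Q gᵀ`, where `a`, `b`, `c`, `d` are the entries of `g`, and `t` those of the
symmetric matrix `Q`. -/
def congruenceEntries (a b c d : ZMod 7) (t : ZMod 7 × ZMod 7 × ZMod 7) :
    ZMod 7 × ZMod 7 × ZMod 7 :=
  (t.1 * a ^ 2 + 2 * t.2.1 * (a * b) + t.2.2 * b ^ 2,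
    t.1 * (a * c) + t.2.1 * (a * d + b * c) + t.2.2 * (b * d),
    t.1 * c ^ 2 + 2 * t.2.1 * (c * d) + t.2.2 * d ^ 2)

theorem mul_symmMatrix_mul_transpose (g : Matrix (Fin 2) (Fin 2) (ZMod 7))
    (t : ZMod 7 × ZMod 7 × ZMod 7) : g * symmMatrix t * gᵀ =
      symmMatrix (congruenceEntries (g 0 0) (g 0 1) (g 1 0) (g 1 1) t) := by
  refine Matrix.ext fun i j => ?_
  fin_cases i <;> fin_cases j <;>
    simp [symmMatrix, congruenceEntries, Matrix.mul_apply, Fin.sum_univ_two] <;> ring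

/-- Only scalar matrices preserve each of the three pairs `{∞, 0}`, `{-1, 1}` and `{-2, 2}`. -/
theorem mem_center_of_fixes (g : SpecialLinearGroup (Fin 2) (ZMod 7))
    (hg : ∀ k : Fin 4, k ≠ 3 → pointPairMap g (vertexPair (k, 0)) = vertexPair (k, 0)) :
    g ∈ Subgroup.center (SpecialLinearGroup (Fin 2) (ZMod 7)) := by
  have hdec : ∀ a b c d : ZMod 7, a * d - b * c = 1 →
      (∀ k : Fin 4, k ≠ 3 →
        congruenceEntries a b c d (vertexForm (k, 0)) = vertexForm (k, 0) ∨
        congruenceEntries a b c d (vertexForm (k, 0)) = -vertexForm (k, 0)) →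
      (a ^ 2 = 1 ∧ d = a) ∧ b = 0 ∧ c = 0 := by
    decide +kernel
  have hk : ∀ k : Fin 4, k ≠ 3 →
      g.1 * symmMatrix (vertexForm (k, 0)) * g.1ᵀ = symmMatrix (vertexForm (k, 0)) ∨
      g.1 * symmMatrix (vertexForm (k, 0)) * g.1ᵀ = -symmMatrix (vertexForm (k, 0)) :=
    fun k hk => Quotient.exact (hg k hk)
  simp only [symmMatrix_neg, mul_symmMatrix_mul_transpose, symmMatrix_injective.eq_iff] at hk
  have hdet := g.2
  rw [det_fin_two] at hdet
  obtain ⟨⟨ha, hd⟩, hb, hc⟩ := hdec _ _ _ _ hdet hk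
  refine Matrix.SpecialLinearGroup.mem_center_iff.2 ⟨g.1 0 0, ha, Matrix.ext fun i j => ?_⟩
  fin_cases i <;> fin_cases j
  exacts [rfl, hb.symm, hc.symm, hd.symm]

theorem isCayleyGraphOn_coxeter :
    IsCayleyGraphOn (arcGraph coxeterGraph.lineGraph)
      (ProjectiveSpecialLinearGroup (Fin 2) (ZMod 7)) := by
  have hcard : Nat.card
      {s : Finset (Fin 7) // s.card = 3 ∧ ∀ i : Fin 7, s ≠ {i, i + 1, i + 3}} = 28 := by
    rw [← Nat.card_congr coxeterEquiv]
    simp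
  refine isCayleyGraphOn_arcGraph_lineGraph coxeter_isNeighborList.ncard_neighborSet coxeterAut
    (by rw [hcard, card_PSL_two_seven]) (x := coxeterEquiv (0, 0)) (y := coxeterEquiv (1, 0))
    (z := coxeterEquiv (2, 0)) ((coxeter_isNeighborList.adj_iff _ _).2 (by decide))
    ((coxeter_isNeighborList.adj_iff _ _).2 (by decide))
    (coxeterEquiv.injective.ne (by decide)) ?_
  intro g
  obtain ⟨g, rfl⟩ := QuotientGroup.mk_surjective g
  intro hx hy hz
  have key : ∀ p, coxeterAut (QuotientGroup.mk g) (coxeterEquiv p) = coxeterEquiv p →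
      pointPairMap g (vertexPair p) = vertexPair p := by
    intro p hp
    have h1 := congrArg coxeterIso hp
    have h2 : coxeterIso (coxeterEquiv p) = vertexPair p := by simp [coxeterIso]
    have h3 : coxeterIso (coxeterAut (QuotientGroup.mk g) (coxeterEquiv p)) =
        pointPairMap g (coxeterIso (coxeterEquiv p)) := coxeterIso.apply_symm_apply _
    rwa [h3, h2] at h1
  refine (QuotientGroup.eq_one_iff g).2 (mem_center_of_fixes g fun k hk => ?_)
  fin_cases k
  exacts [key _ hx, key _ hy, key _ hz, absurd rfl hk]

end ProjectiveSpecialLinearGroup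

end HamDecomp

theorem proposition1 :
    ((HamDecomp.arcGraph HamDecomp.petersenGraph.lineGraph).Connected ∧
      (HamDecomp.arcGraph HamDecomp.petersenGraph.lineGraph).IsRegularOfDegree 4 ∧
      HamDecomp.IsCayleyGraphOn (HamDecomp.arcGraph HamDecomp.petersenGraph.lineGraph)
        (alternatingGroup (Fin 5)) ∧
      ¬ HamDecomp.HasHamiltonDecomposition
        (HamDecomp.arcGraph HamDecomp.petersenGraph.lineGraph)) ∧
    ((HamDecomp.arcGraph HamDecomp.coxeterGraph.lineGraph).Connected ∧
      (HamDecomp.arcGraph HamDecomp.coxeterGraph.lineGraph).IsRegularOfDegree 4 ∧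
      HamDecomp.IsCayleyGraphOn (HamDecomp.arcGraph HamDecomp.coxeterGraph.lineGraph)
        (Matrix.ProjectiveSpecialLinearGroup (Fin 2) (ZMod 7)) ∧
      ¬ HamDecomp.HasHamiltonDecomposition
        (HamDecomp.arcGraph HamDecomp.coxeterGraph.lineGraph)) :=
  ⟨⟨HamDecomp.connected_arcGraph_lineGraph
      HamDecomp.petersen_isNeighborList.ncard_neighborSet HamDecomp.petersenGraph_connected,
    HamDecomp.isRegularOfDegree_arcGraph_lineGraph
      HamDecomp.petersen_isNeighborList.ncard_neighborSet,
    HamDecomp.isCayleyGraphOn_petersen,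
    HamDecomp.not_hasHamiltonDecomposition_arcGraph_lineGraph
      HamDecomp.petersen_isNeighborList.ncard_neighborSet HamDecomp.petersenGraph_connected
      HamDecomp.not_isHamiltonMatching_petersenGraph⟩,
    HamDecomp.connected_arcGraph_lineGraph
      HamDecomp.coxeter_isNeighborList.ncard_neighborSet HamDecomp.coxeterGraph_connected,
    HamDecomp.isRegularOfDegree_arcGraph_lineGraph
      HamDecomp.coxeter_isNeighborList.ncard_neighborSet,
    HamDecomp.isCayleyGraphOn_coxeter,
    HamDecomp.not_hasHamiltonDecomposition_arcGraph_lineGraph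
      HamDecomp.coxeter_isNeighborList.ncard_neighborSet HamDecomp.coxeterGraph_connected
      HamDecomp.not_isHamiltonMatching_coxeterGraph⟩
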